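/- Notation. Let $\mathcal P$ be the space of Dirichlet polynomials $P(s)=\sum_{n\ge1} a_n n^{-s}$ (finite sums, $a_n\in\mathbb C$); for $\sigma>0$ put $P_\sigma(s)=P(\sigma+s)=\sum a_n n^{-\sigma}n^{-s}$. Let $\mathbb T^\infty$ be the infinite-dimensional torus, with coordinates $\chi_q$ indexed by the primes $q$, and $m$ its normalized Haar measure; for $\chi\in\mathbb T^\infty$ and $n\ge1$ put $\chi(n)=\prod_q\chi_q^{v_q(n)}$. For $1\le p<\infty$ let $\|P\|_{\mathcal H^p}=\big(\int_{\mathbb T^\infty}\big|\sum a_n\chi(n)\big|^p\,dm(\chi)\big)^{1/p}$. For $\alpha>-1$ let $\mathcal A^p_\alpha$ be the completion of $\mathcal P$ for the norm $$\|P\|_{\mathcal A^p_\alpha}=\Big(\int_0^{+\infty}\|P_\sigma\|_{\mathcal H^p}^p\,d\mu_\alpha(\sigma)\Big)^{1/p},\qquad d\mu_\alpha(\sigma)=\frac{2^{\alpha+1}}{\Gamma(\alpha+1)}\,\sigma^\alpha e^{-2\sigma}\,d\sigma .$$ The map $P\mapsto a_1$ extends by continuity to $\mathcal A^p_\alpha$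 (the constant coefficient); let $\mathcal A^p_{\alpha,\infty}$ be the subspace of those $f\in\mathcal A^p_\alpha$ whose constant coefficient vanishes. Let $\mathbb C_{1/2}=\{s\in\mathbb C:\Re s>1/2\}$. Theorem. Let $1\le p<\infty$ and $\alpha>-1$. For every $s\in\mathbb C_{1/2}$ the point evaluation $P\mapsto P(s)$ on $\mathcal P$ extends to a bounded linear functional $\delta_s$ on $\mathcal A^p_\alpha$ (necessarily unique), and hence, by restriction, on $\mathcal A^p_{\alpha,\infty}$. Moreover: (i) there is a constant $c_{p,\alpha}>0$, depending only on $p$ and $\alpha$, such that for every $s\in\mathbb C_{1/2}$ $$\|\delta_s\|_{(\mathcal A^p_\alpha)^*}\le c_{p,\alpha}\Big(\frac{\Re s}{2\Re s-1}\Big)^{(2+\alpha)/p};$$ (ii) there is a constant $c'_{p,\alpha}>0$, depending only on $p$ and $\alpha$, such that for every $s\in\mathbb C_{1/2}$ $$\|\delta_s\|_{(\mathcal A^p_{\alpha,\infty})^*}\le \frac{c'_{p,\alpha}}{(2\Re s-1)^{(2+\alpha)/p}}.$$ -/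

import Mathlib

open MeasureTheory Set

noncomputable section

namespace DirichletBergman

/-! ### Dirichlet polynomials -/

/-- A Dirichlet polynomial `∑ aₙ n⁻ˢ` (finite sum over `n ≥ 1`), given by its coefficients. -/
abbrev DirichletPoly : Type := ℕ+ →₀ ℂ

/-- The value `P(s) = ∑ aₙ n⁻ˢ`. -/
def evalPoly (s : ℂ) : DirichletPoly →ₗ[ℂ] ℂ :=
  Finsupp.lsum ℂ fun n : ℕ+ => LinearMap.mulRight ℂ (((n : ℕ) : ℂ) ^ (-s))

/-- The translate `P_σ(s) = P(σ + s)`: its `n`-th coefficient is `aₙ n^(-σ)`. -/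
def translate (σ : ℝ) (P : DirichletPoly) : DirichletPoly :=
  Finsupp.onFinset P.support (fun n : ℕ+ => P n * ((n : ℕ) : ℂ) ^ (-(σ : ℂ))) fun n hn => by
    rw [Finsupp.mem_support_iff]
    rintro h
    simp [h] at hn

/-! ### The infinite polytorus -/

instance instMeasurableSpaceCircle : MeasurableSpace Circle := borel Circle

instance instBorelSpaceCircle : BorelSpace Circle := ⟨rfl⟩

/-- The infinite-dimensional polytorus, with coordinates indexed by the prime numbers. -/
abbrev Polytorus : Type := {q : ℕ // q.Prime} → Circle

/-- The normalized Haar measure on the polytorus. -/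
def haarPolytorus : Measure Polytorus :=
  Measure.haarMeasure (⊤ : TopologicalSpace.PositiveCompacts Polytorus)

instance : IsProbabilityMeasure haarPolytorus :=
  ⟨by
    have := Measure.haarMeasure_self (K₀ := (⊤ : TopologicalSpace.PositiveCompacts Polytorus))
    simpa [haarPolytorus] using this⟩

instance : haarPolytorus.IsMulLeftInvariant := by
  unfold haarPolytorus; infer_instance

/-- The completely multiplicative extension of `χ`:
`χ(n) = ∏ χ_q ^ v_q(n)`, the product being over the primes `q` dividing `n`. -/
def charValue (χ : Polytorus) (n : ℕ) : Circle :=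
  n.factorization.prod fun q k => (if h : q.Prime then χ ⟨q, h⟩ else 1) ^ k

/-- The Bohr lift `D(P)(χ) = ∑ aₙ χ(n)` of a Dirichlet polynomial. -/
def bohrLift (P : DirichletPoly) (χ : Polytorus) : ℂ :=
  P.sum fun n a => a * (charValue χ n : ℂ)

/-! ### The Hardy and Bergman norms of a Dirichlet polynomial -/

/-- `‖P‖_{𝓗^p} = (∫ |D(P)|^p dm)^{1/p}`. -/
def hardyNorm (p : ℝ) (P : DirichletPoly) : ℝ :=
  (∫ χ, ‖bohrLift P χ‖ ^ p ∂haarPolytorus) ^ (1 / p)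

/-- `‖P‖_{𝓐^p_μ} = (∫_0^∞ ‖P_σ‖_{𝓗^p}^p dμ(σ))^{1/p}`. -/
def bergmanNorm (p : ℝ) (μ : Measure ℝ) (P : DirichletPoly) : ℝ :=
  (∫ σ in Ioi 0, hardyNorm p (translate σ P) ^ p ∂μ) ^ (1 / p)

/-- The measure `dμ_α(σ) = 2^{α+1} / Γ(α+1) σ^α e^{-2σ} dσ` on `(0, ∞)`. -/
def muAlpha (α : ℝ) : Measure ℝ :=
  (volume.restrict (Ioi 0)).withDensity fun σ =>
    ENNReal.ofReal (2 ^ (α + 1) / Real.Gamma (α + 1) * σ ^ α * Real.exp (-2 * σ))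

/-! ### These are norms -/

lemma charValue_mul (ψ χ : Polytorus) (n : ℕ) :
    charValue (ψ * χ) n = charValue ψ n * charValue χ n := by
  unfold charValue Finsupp.prod
  rw [← Finset.prod_mul_distrib]
  refine Finset.prod_congr rfl fun q _ => ?_
  dsimp only
  split_ifs <;> simp [mul_pow]

lemma continuous_charValue (n : ℕ) : Continuous fun χ => charValue χ n := by
  unfold charValue Finsupp.prod
  refine continuous_finsetProd _ fun q _ => ?_
  dsimp only
  split_ifs <;> fun_prop

lemma bohrLift_add (P Q : DirichletPoly) : bohrLift (P + Q) = bohrLift P + bohrLift Q := by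
  ext χ
  exact Finsupp.sum_add_index' (by simp) (by intros; ring)

lemma bohrLift_smul (c : ℂ) (P : DirichletPoly) : bohrLift (c • P) = c • bohrLift P := by
  ext χ
  simp only [bohrLift, Pi.smul_apply, smul_eq_mul]
  rw [Finsupp.sum_smul_index (by simp), Finsupp.sum, Finsupp.sum, Finset.mul_sum]
  simp [mul_assoc]

lemma continuous_bohrLift (P : DirichletPoly) : Continuous (bohrLift P) := by
  unfold bohrLift Finsupp.sum
  refine continuous_finsetSum _ fun n _ => ?_
  exact continuous_const.mul (continuous_subtype_val.comp (continuous_charValue n))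

lemma integrable_of_cont {f : Polytorus → ℂ} (hf : Continuous f) :
    Integrable f haarPolytorus :=
  hf.integrable_of_hasCompactSupport (HasCompactSupport.of_compactSpace f)

lemma integral_char_mul_conj {k n : ℕ} (hk : k ≠ 0) (hn : n ≠ 0) (hkn : k ≠ n) :
    ∫ χ, (charValue χ k : ℂ) * ((charValue χ n)⁻¹ : Circle) ∂haarPolytorus = 0 := by
  obtain ⟨q, hq⟩ : ∃ q, k.factorization q ≠ n.factorization q := by
    by_contra! h
    exact hkn (Nat.eq_of_factorization_eq hk hn h)
  have hqp : q.Prime := by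
    by_contra h
    simp [Nat.factorization_eq_zero_of_not_prime _ h] at hq
  set a := k.factorization q with ha
  set b := n.factorization q with hb
  have hab : (a : ℝ) - b ≠ 0 := sub_ne_zero.2 (by exact_mod_cast hq)
  let z : Circle := Circle.exp (Real.pi / (a - b))
  let ψ : Polytorus := Pi.mulSingle ⟨q, hqp⟩ z
  have hψ : ∀ m : ℕ, charValue ψ m = z ^ (m.factorization q) := by
    intro m
    unfold charValue
    rw [Finsupp.prod, Finset.prod_eq_single q]
    · rw [dif_pos hqp]
      congr 1
      exact Pi.mulSingle_eq_same (M := fun _ => Circle) _ z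
    · intro r _ hr
      split_ifs with h
      · have : (⟨r, h⟩ : {q : ℕ // q.Prime}) ≠ ⟨q, hqp⟩ := fun e => hr (congrArg Subtype.val e)
        have h1 : ψ ⟨r, h⟩ = 1 := Pi.mulSingle_eq_of_ne (M := fun _ => Circle) this z
        rw [h1, one_pow]
      · simp
    · intro h
      simp [Finsupp.notMem_support_iff.1 h]
  have hz : z ^ a * (z ^ b)⁻¹ = Circle.exp Real.pi := by
    have : Circle.exp Real.pi = Circle.exp ((a : ℝ) * (Real.pi / (a - b)) - b * (Real.pi / (a - b))) := by
      congr 1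
      field_simp
    rw [this, Circle.exp_sub, div_eq_mul_inv]
    simp [z, ← Circle.exp_natCast_mul]
  have hpi : ((Circle.exp Real.pi : Circle) : ℂ) = -1 := by simp
  have key := integral_mul_left_eq_self (μ := haarPolytorus)
    (fun χ : Polytorus => (charValue χ k : ℂ) * ((charValue χ n)⁻¹ : Circle)) ψ
  have h2 : ∀ χ : Polytorus,
      (charValue (ψ * χ) k : ℂ) * ((charValue (ψ * χ) n)⁻¹ : Circle)
        = -((charValue χ k : ℂ) * ((charValue χ n)⁻¹ : Circle)) := by
    intro χ
    rw [← neg_one_mul, ← hpi, ← hz, charValue_mul, charValue_mul, hψ, hψ, mul_inv]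
    simp only [Circle.coe_mul]
    ring
  simp only [h2, integral_neg] at key
  have : (2 : ℂ) * ∫ χ, (charValue χ k : ℂ) * ((charValue χ n)⁻¹ : Circle) ∂haarPolytorus = 0 := by
    linear_combination -key
  simpa using this

lemma integral_bohrLift_mul (P : DirichletPoly) (n : ℕ+) :
    ∫ χ, bohrLift P χ * ((charValue χ n)⁻¹ : Circle) ∂haarPolytorus = P n := by
  simp only [bohrLift, Finsupp.sum, Finset.sum_mul, mul_assoc]
  rw [integral_finsetSum]
  · simp only [integral_const_mul]
    rw [Finset.sum_eq_single n]
    · have : ∀ χ : Polytorus, (charValue χ n : ℂ) * ((charValue χ n)⁻¹ : Circle) = 1 := by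
        intro χ; rw [← Circle.coe_mul]; simp
      simp only [this]
      simp
    · intro k _ hk
      rw [integral_char_mul_conj k.ne_zero n.ne_zero (fun h => hk (PNat.coe_injective h)), mul_zero]
    · intro h
      simp [Finsupp.notMem_support_iff.1 h]
  · intro k _
    refine integrable_of_cont ?_
    have h1 := continuous_charValue k
    have h2 := continuous_charValue n
    fun_prop

lemma memLp_bohrLift (q : ENNReal) (P : DirichletPoly) : MemLp (bohrLift P) q haarPolytorus :=
  (continuous_bohrLift P).memLp_of_hasCompactSupport (HasCompactSupport.of_compactSpace _)

lemma hardyNorm_eq {p : ℝ} (hp : 1 ≤ p) (P : DirichletPoly) :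
    hardyNorm p P = lpNorm (bohrLift P) (ENNReal.ofReal p) haarPolytorus := by
  have hp0 : 0 < p := by linarith
  rw [lpNorm_eq_integral_norm_rpow_toReal (by simpa using hp0) (by simp)
    (memLp_bohrLift 1 P).aestronglyMeasurable, ENNReal.toReal_ofReal hp0.le, hardyNorm, one_div]

lemma one_le_ofReal' {p : ℝ} (hp : 1 ≤ p) : 1 ≤ ENNReal.ofReal p := by simpa using hp

lemma hardyNorm_nonneg (p : ℝ) (P : DirichletPoly) : 0 ≤ hardyNorm p P := by
  unfold hardyNorm; positivity

lemma hardyNorm_add_le {p : ℝ} (hp : 1 ≤ p) (P Q : DirichletPoly) :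
    hardyNorm p (P + Q) ≤ hardyNorm p P + hardyNorm p Q := by
  simp only [hardyNorm_eq hp, bohrLift_add]
  exact lpNorm_add_le (memLp_bohrLift _ P) (one_le_ofReal' hp)

lemma hardyNorm_smul {p : ℝ} (hp : 1 ≤ p) (c : ℂ) (P : DirichletPoly) :
    hardyNorm p (c • P) = ‖c‖ * hardyNorm p P := by
  simp only [hardyNorm_eq hp, bohrLift_smul, lpNorm_const_smul, coe_nnnorm]

lemma norm_coeff_le_hardyNorm {p : ℝ} (hp : 1 ≤ p) (P : DirichletPoly) (n : ℕ+) :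
    ‖P n‖ ≤ hardyNorm p P := by
  rw [hardyNorm_eq hp, ← integral_bohrLift_mul P n]
  calc _ ≤ ∫ χ, ‖bohrLift P χ * ((charValue χ n)⁻¹ : Circle)‖ ∂haarPolytorus :=
        norm_integral_le_integral_norm _
    _ = lpNorm (bohrLift P) 1 haarPolytorus := by
        rw [lpNorm_one_eq_integral_norm (memLp_bohrLift 1 P).aestronglyMeasurable]
        simp only [norm_mul, Circle.norm_coe, mul_one]
    _ ≤ _ := by
        rw [← toReal_eLpNorm (memLp_bohrLift 1 P).aestronglyMeasurable,
          ← toReal_eLpNorm (memLp_bohrLift 1 P).aestronglyMeasurable]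
        exact ENNReal.toReal_mono (memLp_bohrLift _ P).eLpNorm_ne_top
          (eLpNorm_le_eLpNorm_of_exponent_le (one_le_ofReal' hp)
            (memLp_bohrLift 1 P).aestronglyMeasurable)

@[simp] lemma translate_apply (σ : ℝ) (P : DirichletPoly) (n : ℕ+) :
    translate σ P n = P n * ((n : ℕ) : ℂ) ^ (-(σ : ℂ)) := rfl

lemma translate_add (σ : ℝ) (P Q : DirichletPoly) :
    translate σ (P + Q) = translate σ P + translate σ Q := by
  ext n; simp [add_mul]

lemma translate_smul (σ : ℝ) (c : ℂ) (P : DirichletPoly) :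
    translate σ (c • P) = c • translate σ P := by
  ext n; simp [mul_assoc]

lemma evalPoly_apply (s : ℂ) (P : DirichletPoly) :
    evalPoly s P = P.sum fun n a => a * ((n : ℕ) : ℂ) ^ (-s) := by
  simp only [evalPoly, Finsupp.lsum_apply]
  rfl

lemma bohrLift_translate (σ : ℝ) (P : DirichletPoly) (χ : Polytorus) :
    bohrLift (translate σ P) χ
      = ∑ n ∈ P.support, P n * ((n : ℕ) : ℂ) ^ (-(σ : ℂ)) * (charValue χ n : ℂ) := by
  unfold bohrLift translate
  rw [Finsupp.onFinset_sum _ (by simp)]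

lemma norm_bohrLift_translate_le {σ : ℝ} (hσ : 0 ≤ σ) (P : DirichletPoly) (χ : Polytorus) :
    ‖bohrLift (translate σ P) χ‖ ≤ ∑ n ∈ P.support, ‖P n‖ := by
  rw [bohrLift_translate]
  refine (norm_sum_le _ _).trans (Finset.sum_le_sum fun n _ => ?_)
  have h1 : ‖((n : ℕ) : ℂ) ^ (-(σ : ℂ))‖ ≤ 1 := by
    rw [Complex.norm_natCast_cpow_of_pos n.pos]
    exact Real.rpow_le_one_of_one_le_of_nonpos (by exact_mod_cast n.pos) (by simpa using hσ)
  rw [norm_mul, norm_mul, Circle.norm_coe, mul_one]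
  exact mul_le_of_le_one_right (norm_nonneg _) h1

lemma hardyNorm_translate_le {p : ℝ} (hp : 1 ≤ p) {σ : ℝ} (hσ : 0 ≤ σ) (P : DirichletPoly) :
    hardyNorm p (translate σ P) ≤ ∑ n ∈ P.support, ‖P n‖ := by
  have hp0 : 0 < p := by linarith
  have hS : 0 ≤ ∑ n ∈ P.support, ‖P n‖ := Finset.sum_nonneg fun _ _ => norm_nonneg _
  have h : ∫ χ, ‖bohrLift (translate σ P) χ‖ ^ p ∂haarPolytorus
      ≤ (∑ n ∈ P.support, ‖P n‖) ^ p := by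
    refine (integral_mono_of_nonneg (.of_forall fun χ => by positivity)
      (integrable_const ((∑ n ∈ P.support, ‖P n‖) ^ p)) (.of_forall fun χ => ?_)).trans (by simp)
    exact Real.rpow_le_rpow (norm_nonneg _) (norm_bohrLift_translate_le hσ P χ) hp0.le
  calc hardyNorm p (translate σ P) ≤ ((∑ n ∈ P.support, ‖P n‖) ^ p) ^ (1 / p) :=
        Real.rpow_le_rpow (integral_nonneg fun χ => by positivity) h (by positivity)
    _ = _ := by rw [one_div, Real.rpow_rpow_inv hS hp0.ne']

lemma continuous_hardyNorm_translate {p : ℝ} (hp : 1 ≤ p) (P : DirichletPoly) :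
    Continuous fun σ => hardyNorm p (translate σ P) := by
  have hp0 : 0 < p := by linarith
  unfold hardyNorm
  refine Continuous.rpow_const ?_ (fun _ => Or.inr (by positivity))
  have hc : Continuous (Function.uncurry fun (σ : ℝ) (χ : Polytorus) =>
      ‖bohrLift (translate σ P) χ‖ ^ p) := by
    refine Continuous.rpow_const (Continuous.norm ?_) (fun _ => Or.inr hp0.le)
    simp only [bohrLift_translate]
    refine continuous_finsetSum _ fun n _ => ?_
    have h1 := continuous_charValue n
    have h2 : Continuous fun x : ℝ × Polytorus => ((n : ℕ) : ℂ) ^ (-(x.1 : ℂ)) :=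
      Continuous.const_cpow (by fun_prop) (Or.inl (by exact_mod_cast n.ne_zero))
    have h3 : Continuous fun x : ℝ × Polytorus => (charValue x.2 n : ℂ) :=
      continuous_subtype_val.comp (h1.comp continuous_snd)
    exact (continuous_const.mul h2).mul h3
  have := continuous_parametric_integral_of_continuous (μ := haarPolytorus) hc
    (s := Set.univ) isCompact_univ
  simpa using this

lemma muAlpha_restrict (α : ℝ) : (muAlpha α).restrict (Ioi 0) = muAlpha α := by
  unfold muAlpha
  rw [restrict_withDensity measurableSet_Ioi, Measure.restrict_restrict measurableSet_Ioi,
    Set.inter_self]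

lemma isProbabilityMeasure_muAlpha {α : ℝ} (hα : -1 < α) : IsProbabilityMeasure (muAlpha α) := by
  constructor
  have ha : 0 < α + 1 := by linarith
  have hG := Real.Gamma_pos_of_pos ha
  have hint := Real.integral_rpow_mul_exp_neg_mul_Ioi (a := α + 1) (r := 2) ha (by norm_num)
  have hfun : ∀ σ : ℝ, 2 ^ (α + 1) / Real.Gamma (α + 1) * σ ^ α * Real.exp (-2 * σ)
      = 2 ^ (α + 1) / Real.Gamma (α + 1) * (σ ^ (α + 1 - 1) * Real.exp (-(2 * σ))) := by
    intro σ; rw [add_sub_cancel_right]; ring_nf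
  have hone : ∫ σ in Ioi (0 : ℝ),
      2 ^ (α + 1) / Real.Gamma (α + 1) * σ ^ α * Real.exp (-2 * σ) = 1 := by
    simp only [hfun]
    rw [integral_const_mul, hint, Real.div_rpow (by norm_num) (by norm_num), Real.one_rpow]
    have : (0 : ℝ) < 2 ^ (α + 1) := by positivity
    field_simp
  rw [muAlpha, withDensity_apply _ MeasurableSet.univ, Measure.restrict_univ,
    ← ofReal_integral_eq_lintegral_ofReal, hone, ENNReal.ofReal_one]
  · by_contra h
    rw [integral_undef h] at hone
    norm_num at hone
  · filter_upwards [self_mem_ae_restrict measurableSet_Ioi] with σ hσ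
    have : (0 : ℝ) < σ := hσ
    positivity

lemma memLp_hardyNorm_translate {p : ℝ} (hp : 1 ≤ p) {α : ℝ} (hα : -1 < α) (q : ENNReal)
    (P : DirichletPoly) : MemLp (fun σ => hardyNorm p (translate σ P)) q (muAlpha α) := by
  have := isProbabilityMeasure_muAlpha hα
  refine MemLp.of_bound (continuous_hardyNorm_translate hp P).aestronglyMeasurable
    (∑ n ∈ P.support, ‖P n‖) ?_
  rw [← muAlpha_restrict]
  filter_upwards [self_mem_ae_restrict measurableSet_Ioi] with σ hσ
  rw [Real.norm_of_nonneg (hardyNorm_nonneg _ _)]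
  exact hardyNorm_translate_le hp (le_of_lt hσ) P

lemma bergmanNorm_eq {p : ℝ} (hp : 1 ≤ p) (α : ℝ) (P : DirichletPoly) :
    bergmanNorm p (muAlpha α) P
      = lpNorm (fun σ => hardyNorm p (translate σ P)) (ENNReal.ofReal p) (muAlpha α) := by
  have hp0 : 0 < p := by linarith
  rw [lpNorm_eq_integral_norm_rpow_toReal (by simpa using hp0) (by simp)
    (continuous_hardyNorm_translate hp P).aestronglyMeasurable, ENNReal.toReal_ofReal hp0.le,
    bergmanNorm, one_div, muAlpha_restrict]
  simp only [Real.norm_of_nonneg (hardyNorm_nonneg _ _)]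

lemma bergmanNorm_nonneg (p : ℝ) (μ : Measure ℝ) (P : DirichletPoly) : 0 ≤ bergmanNorm p μ P := by
  unfold bergmanNorm
  exact Real.rpow_nonneg (integral_nonneg fun σ => Real.rpow_nonneg (hardyNorm_nonneg _ _) _) _

lemma lpNorm_mono_of_le {q : ENNReal} {μ : Measure ℝ} {f g : ℝ → ℝ} (hf : MemLp f q μ)
    (hg : MemLp g q μ) (hf0 : ∀ x, 0 ≤ f x) (h : ∀ x, f x ≤ g x) :
    lpNorm f q μ ≤ lpNorm g q μ := by
  rw [← toReal_eLpNorm hf.aestronglyMeasurable, ← toReal_eLpNorm hg.aestronglyMeasurable]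
  refine ENNReal.toReal_mono hg.eLpNorm_ne_top (eLpNorm_mono_real fun x => ?_)
  rw [Real.norm_of_nonneg (hf0 x)]
  exact h x

lemma bergmanNorm_add_le {p : ℝ} (hp : 1 ≤ p) {α : ℝ} (hα : -1 < α) (P Q : DirichletPoly) :
    bergmanNorm p (muAlpha α) (P + Q)
      ≤ bergmanNorm p (muAlpha α) P + bergmanNorm p (muAlpha α) Q := by
  simp only [bergmanNorm_eq hp]
  refine (lpNorm_mono_of_le (memLp_hardyNorm_translate hp hα _ _)
    ((memLp_hardyNorm_translate hp hα _ P).add (memLp_hardyNorm_translate hp hα _ Q))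
    (fun _ => hardyNorm_nonneg _ _) fun σ => ?_).trans
    (lpNorm_add_le (memLp_hardyNorm_translate hp hα _ P) (one_le_ofReal' hp))
  rw [translate_add]
  exact hardyNorm_add_le hp _ _

lemma bergmanNorm_smul {p : ℝ} (hp : 1 ≤ p) (α : ℝ) (c : ℂ) (P : DirichletPoly) :
    bergmanNorm p (muAlpha α) (c • P) = ‖c‖ * bergmanNorm p (muAlpha α) P := by
  simp only [bergmanNorm_eq hp, translate_smul, hardyNorm_smul hp]
  have := lpNorm_const_smul (p := ENNReal.ofReal p) (‖c‖ : ℝ)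
    (fun σ => hardyNorm p (translate σ P)) (muAlpha α)
  simpa [Pi.smul_def] using this

lemma norm_coeff_one_le {p : ℝ} (hp : 1 ≤ p) {α : ℝ} (hα : -1 < α) (P : DirichletPoly) :
    ‖P 1‖ ≤ bergmanNorm p (muAlpha α) P := by
  have := isProbabilityMeasure_muAlpha hα
  have hp0 : 0 < p := by linarith
  have h1 : lpNorm (fun _ : ℝ => ‖P 1‖) (ENNReal.ofReal p) (muAlpha α) = ‖P 1‖ := by
    rw [lpNorm_const' (by simpa using hp0) (by simp)]
    simp
  rw [bergmanNorm_eq hp, ← h1]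
  refine lpNorm_mono_of_le (memLp_const _) (memLp_hardyNorm_translate hp hα _ P)
    (fun _ => norm_nonneg _) fun σ => ?_
  simpa using norm_coeff_le_hardyNorm hp (translate σ P) 1

lemma eq_zero_of_bergmanNorm_eq_zero {p : ℝ} (hp : 1 ≤ p) {α : ℝ} (hα : -1 < α)
    (P : DirichletPoly) (h : bergmanNorm p (muAlpha α) P = 0) : P = 0 := by
  have := isProbabilityMeasure_muAlpha hα
  have hp0 : 0 < p := by linarith
  rw [bergmanNorm_eq hp, lpNorm_eq_zero (memLp_hardyNorm_translate hp hα _ P)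
    (by simpa using hp0)] at h
  obtain ⟨σ, hσ⟩ := h.exists
  ext n
  have h1 := norm_coeff_le_hardyNorm hp (translate σ P) n
  have hσ' : hardyNorm p (translate σ P) = 0 := hσ
  rw [hσ'] at h1
  have h2 : translate σ P n = 0 := norm_le_zero_iff.1 h1
  have h3 : ((n : ℕ) : ℂ) ^ (-(σ : ℂ)) ≠ 0 := by
    simp [Complex.cpow_eq_zero_iff]
  simpa [h3] using h2

/-! ### The spaces `𝓐^p_α` and `𝓐^p_{α,∞}` -/

/-- The Dirichlet polynomials, to be equipped with the norm of `𝓐^p_α`. -/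
def BergmanPoly (_p _α : ℝ) : Type := DirichletPoly

namespace BergmanPoly

variable (p α : ℝ)

instance : AddCommGroup (BergmanPoly p α) := inferInstanceAs (AddCommGroup DirichletPoly)

instance : Module ℂ (BergmanPoly p α) := inferInstanceAs (Module ℂ DirichletPoly)

/-- The identity map from Dirichlet polynomials to the normed space of Dirichlet polynomials. -/
def ofPoly : DirichletPoly ≃ₗ[ℂ] BergmanPoly p α := LinearEquiv.refl ℂ DirichletPoly

instance : Norm (BergmanPoly p α) :=
  ⟨fun P => bergmanNorm p (muAlpha α) ((ofPoly p α).symm P)⟩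

variable [hp : Fact (1 ≤ p)] [hα : Fact (-1 < α)]

lemma normCore : NormedSpace.Core ℂ (BergmanPoly p α) where
  norm_nonneg P := bergmanNorm_nonneg _ _ _
  norm_smul c P := bergmanNorm_smul hp.out α c ((ofPoly p α).symm P)
  norm_triangle P Q :=
    bergmanNorm_add_le hp.out hα.out ((ofPoly p α).symm P) ((ofPoly p α).symm Q)
  norm_eq_zero_iff P := by
    refine ⟨fun h => eq_zero_of_bergmanNorm_eq_zero hp.out hα.out ((ofPoly p α).symm P) h, ?_⟩
    rintro rfl
    have := bergmanNorm_smul hp.out α 0 0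
    rw [zero_smul, norm_zero, zero_mul] at this
    exact this

instance : NormedAddCommGroup (BergmanPoly p α) := NormedAddCommGroup.ofCore (normCore p α)

instance : NormedSpace ℂ (BergmanPoly p α) := NormedSpace.ofCore (normCore p α)

/-- The constant coefficient `a₁` of a Dirichlet polynomial, as a bounded functional. -/
def constCoeff : BergmanPoly p α →L[ℂ] ℂ :=
  LinearMap.mkContinuous
    ((Finsupp.lapply 1 : DirichletPoly →ₗ[ℂ] ℂ) ∘ₗ (ofPoly p α).symm.toLinearMap) 1 fun P => by
      rw [one_mul]
      exact norm_coeff_one_le hp.out hα.out ((ofPoly p α).symm P)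

end BergmanPoly

variable (p α : ℝ) [Fact (1 ≤ p)] [Fact (-1 < α)]

/-- The Bergman space `𝓐^p_α`: the completion of the Dirichlet polynomials for the norm
`‖·‖_{𝓐^p_{μ_α}}`. -/
abbrev BergmanSpace : Type := UniformSpace.Completion (BergmanPoly p α)

/-- A Dirichlet polynomial as an element of `𝓐^p_α`. -/
def toBergman (P : DirichletPoly) : BergmanSpace p α :=
  ((BergmanPoly.ofPoly p α P : BergmanPoly p α) : BergmanSpace p α)

/-- The constant coefficient `a₁` of an element of `𝓐^p_α` (the continuous extension of the
constant coefficient of Dirichlet polynomials). -/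
def constCoeff : BergmanSpace p α →L[ℂ] ℂ :=
  (BergmanPoly.constCoeff p α).extend UniformSpace.Completion.toComplL

/-- The subspace `𝓐^p_{α,∞}` of `𝓐^p_α`: the functions whose constant coefficient vanishes. -/
def BergmanSpaceInfty : Submodule ℂ (BergmanSpace p α) :=
  LinearMap.ker (constCoeff p α).toLinearMap

lemma constCoeff_toBergman (P : DirichletPoly) : constCoeff p α (toBergman p α P) = P 1 :=
  ContinuousLinearMap.extend_eq (BergmanPoly.constCoeff p α)
    (e := (UniformSpace.Completion.toComplL : BergmanPoly p α →L[ℂ] BergmanSpace p α))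
    UniformSpace.Completion.denseRange_coe
    (UniformSpace.Completion.isUniformInducing_coe _) (BergmanPoly.ofPoly p α P)

lemma norm_toBergman (P : DirichletPoly) :
    ‖toBergman p α P‖ = bergmanNorm p (muAlpha α) P :=
  UniformSpace.Completion.norm_coe _

/-- `δ` is the point evaluation at `s`: the bounded functional on `𝓐^p_α` which sends every
Dirichlet polynomial `P` to `P(s)` (it is unique, by density). -/
def IsPointEvaluation (s : ℂ) (δ : BergmanSpace p α →L[ℂ] ℂ) : Prop :=
  ∀ P : DirichletPoly, δ (toBergman p α P) = evalPoly s P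

end DirichletBergman

end

open MeasureTheory Set

noncomputable section

namespace DirichletBergman

open scoped ComplexConjugate

/-! The core is a Hardy space estimate (`norm_evalPoly_le_hardyNorm`): for Re s > 1/2, |P(s)| ≤ (2
Re s/(2 Re s - 1))^{1/p} ‖P‖_{𝓗^p}. Only finitely many primes divide the n in the support of P, so
one may work with the reproducing kernel k in those variables. The functional Φ(g) = ∫ g k̄ sends
χ(n) to n^{-s}, hence is multiplicative on the closed algebra of analytic functions. The Euler
product makes k = exp h with h in this algebra, so k^a = exp(a h) is analytic for every real a. With
K = ‖k‖₂² = Φ(k) ≤ ζ(2 Re s) and a = 1 - 2/p, multiplicativity gives |Φ(f k^a)| = |P(s)| K^a, where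
f is the Bohr lift of P, while Hölder bounds it by ∫ |f| |k|^{2-2/p} ≤ ‖f‖_p K^{1-1/p}. Dividing
leaves K^{1/p}.

For (i), P(s) = P_η(s - η), and the Hardy estimate is averaged over 0 < η ≤ t, with t comparable to
min(1, Re s - 1/2). Since μ_α((0,t]) is at least a constant times t^{α+1}, the exponent 1/p becomes
(2+α)/p.

For (ii), (i) suffices while Re s stays bounded. For Re s ≥ 4, the coefficients satisfy |a_n| ≤ c n
‖P‖, so P(s) - a₁ is O(2^{-Re s}) ‖P‖, which beats any power of 2 Re s - 1. Density carries
everything over to the completion. -/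

/-! ### Analytic functions on the polytorus -/

/-- The character `χ ↦ χ(n)` as a continuous function on the polytorus. -/
def torusChar (n : ℕ) : C(Polytorus, ℂ) :=
  ⟨fun χ => (charValue χ n : ℂ), continuous_subtype_val.comp (continuous_charValue n)⟩

@[simp] lemma torusChar_apply (n : ℕ) (χ : Polytorus) : torusChar n χ = (charValue χ n : ℂ) := rfl

lemma charValue_one (χ : Polytorus) : charValue χ 1 = 1 := by simp [charValue]

lemma charValue_mul_right (χ : Polytorus) {m n : ℕ} (hm : m ≠ 0) (hn : n ≠ 0) :
    charValue χ (m * n) = charValue χ m * charValue χ n := by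
  unfold charValue
  rw [Nat.factorization_mul hm hn, Finsupp.prod_add_index' (by simp) (by intros; rw [pow_add])]

lemma torusChar_one : torusChar 1 = 1 := by
  ext χ; simp [charValue_one]

lemma torusChar_mul {m n : ℕ} (hm : m ≠ 0) (hn : n ≠ 0) :
    torusChar (m * n) = torusChar m * torusChar n := by
  ext χ; simp [charValue_mul_right χ hm hn]

lemma norm_torusChar_le (n : ℕ) : ‖torusChar n‖ ≤ 1 :=
  (ContinuousMap.norm_le _ zero_le_one).2 fun _ => (Circle.norm_coe _).le

/-- Integration against the Haar measure, as a functional on continuous functions. -/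
def haarIntegral : C(Polytorus, ℂ) →L[ℂ] ℂ :=
  LinearMap.mkContinuous
    { toFun := fun g => ∫ χ, g χ ∂haarPolytorus
      map_add' := fun f g => integral_add (integrable_of_cont f.continuous)
        (integrable_of_cont g.continuous)
      map_smul' := fun c f => integral_const_mul c _ } 1 fun g => by
    rw [one_mul]
    refine (norm_integral_le_of_norm_le_const (.of_forall fun χ => g.norm_coe_le_norm χ)).trans ?_
    simp

lemma haarIntegral_apply (g : C(Polytorus, ℂ)) :
    haarIntegral g = ∫ χ, g χ ∂haarPolytorus := rfl

lemma haarIntegral_torusChar_mul_star {m n : ℕ} (hm : m ≠ 0) (hn : n ≠ 0) :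
    haarIntegral (torusChar m * star (torusChar n)) = if m = n then 1 else 0 := by
  have h : ∀ χ, (torusChar m * star (torusChar n)) χ
      = (charValue χ m : ℂ) * ((charValue χ n)⁻¹ : Circle) := fun χ => by
    rw [Circle.coe_inv_eq_conj]; rfl
  simp only [haarIntegral_apply, h]
  split_ifs with hmn
  · subst hmn
    have : ∀ χ : Polytorus, (charValue χ m : ℂ) * ((charValue χ m)⁻¹ : Circle) = 1 := by
      intro χ; rw [← Circle.coe_mul]; simp
    simp only [this]
    simp
  · exact integral_char_mul_conj hm hn hmn

/-! ### Functionals multiplicative on a subalgebra, and the exponential -/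

/-- A functional which is multiplicative on a closed subalgebra commutes with the exponential
there. -/
lemma map_exp_of_mul {A : Type*} [NormedCommRing A] [NormedAlgebra ℂ A] [CompleteSpace A]
    (B : Subalgebra ℂ A) (Φ : A →L[ℂ] ℂ) (h1 : Φ 1 = 1)
    (hmul : ∀ x ∈ B, ∀ y ∈ B, Φ (x * y) = Φ x * Φ y) {x : A} (hx : x ∈ B) :
    Φ (NormedSpace.exp x) = Complex.exp (Φ x) := by
  have hpow : ∀ n : ℕ, Φ (x ^ n) = Φ x ^ n := fun n => by
    induction n with
    | zero => simp [h1]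
    | succ n ih => rw [pow_succ, hmul _ (pow_mem hx n) _ hx, ih, pow_succ]
  have e1 := (NormedSpace.exp_series_hasSum_exp' (𝕂 := ℂ) x).mapL Φ
  simp only [map_smul, hpow] at e1
  rw [Complex.exp_eq_exp_ℂ]
  exact e1.unique (NormedSpace.exp_series_hasSum_exp' (𝕂 := ℂ) (Φ x))

/-- A bounded functional which is multiplicative on a submonoid is multiplicative on the closed
subalgebra which it generates. -/
lemma map_mul_of_mem_closure_adjoin {A : Type*} [NormedCommRing A] [NormedAlgebra ℂ A]
    (M : Submonoid A) (Φ : A →L[ℂ] ℂ) (hM : ∀ x ∈ M, ∀ y ∈ M, Φ (x * y) = Φ x * Φ y) {x y : A}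
    (hx : x ∈ (Algebra.adjoin ℂ (M : Set A)).topologicalClosure)
    (hy : y ∈ (Algebra.adjoin ℂ (M : Set A)).topologicalClosure) :
    Φ (x * y) = Φ x * Φ y := by
  have h1 : ∀ x ∈ Algebra.adjoin ℂ (M : Set A), ∀ y ∈ Algebra.adjoin ℂ (M : Set A),
      Φ (x * y) = Φ x * Φ y := by
    intro x hx y hy
    rw [← Subalgebra.mem_toSubmodule, Algebra.adjoin_eq_span, Submonoid.closure_eq] at hx hy
    induction hx, hy using Submodule.span_induction₂ with
    | mem_mem x y hx hy => exact hM x hx y hy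
    | zero_left y hy => simp
    | zero_right x hx => simp
    | add_left x y z _ _ _ h1 h2 => rw [add_mul, map_add, h1, h2, map_add, add_mul]
    | add_right x y z _ _ _ h1 h2 => rw [mul_add, map_add, h1, h2, map_add, mul_add]
    | smul_left r x y _ _ h => rw [smul_mul_assoc, map_smul, h, map_smul, smul_mul_assoc]
    | smul_right r x y _ _ h => rw [mul_smul_comm, map_smul, h, map_smul, mul_smul_comm]
  have hc : IsClosed {z : A × A | Φ (z.1 * z.2) = Φ z.1 * Φ z.2} :=
    isClosed_eq (by fun_prop) (by fun_prop)
  have hcl : (x, y) ∈ closure ((Algebra.adjoin ℂ (M : Set A) : Set A) ×ˢ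
      (Algebra.adjoin ℂ (M : Set A) : Set A)) := by
    rw [closure_prod_eq]
    exact ⟨hx, hy⟩
  exact hc.closure_subset_iff.2 (fun z hz => h1 _ hz.1 _ hz.2) hcl

lemma exp_mem_of_isClosed {A : Type*} [NormedCommRing A] [NormedAlgebra ℂ A] [CompleteSpace A]
    (B : Subalgebra ℂ A) (hB : IsClosed (B : Set A)) {x : A} (hx : x ∈ B) :
    NormedSpace.exp x ∈ B := by
  rw [NormedSpace.exp_eq_tsum ℂ]
  exact tsum_mem hB fun i => B.smul_mem (pow_mem hx i) _

lemma exp_continuousMap_apply {X : Type*} [TopologicalSpace X] [CompactSpace X]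
    (f : C(X, ℂ)) (x : X) : NormedSpace.exp f x = Complex.exp (f x) := by
  have h := (NormedSpace.exp_series_hasSum_exp' (𝕂 := ℂ) f).mapL (ContinuousMap.evalCLM ℂ x)
  rw [Complex.exp_eq_exp_ℂ]
  refine HasSum.unique ?_ (NormedSpace.exp_series_hasSum_exp' (𝕂 := ℂ) (f x))
  simpa using h

lemma one_mem_smoothNumbers (N : ℕ) : 1 ∈ N.smoothNumbers := by
  simp [Nat.mem_smoothNumbers]

/-- The submonoid of characters `χ ↦ χ(n)` with `n` an `N`-smooth number. -/
def smoothChars (N : ℕ) : Submonoid C(Polytorus, ℂ) where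
  carrier := torusChar '' N.smoothNumbers
  one_mem' := ⟨1, one_mem_smoothNumbers N, torusChar_one⟩
  mul_mem' := by
    rintro _ _ ⟨m, hm, rfl⟩ ⟨n, hn, rfl⟩
    exact ⟨m * n, Nat.mul_mem_smoothNumbers hm hn,
      torusChar_mul (Nat.ne_zero_of_mem_smoothNumbers hm) (Nat.ne_zero_of_mem_smoothNumbers hn)⟩

/-- The algebra of analytic polynomials in the variables `χ_q`, `q < N`. -/
def smoothAlgebra (N : ℕ) : Subalgebra ℂ C(Polytorus, ℂ) :=
  Algebra.adjoin ℂ (smoothChars N)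

lemma torusChar_mem_smoothAlgebra {N m : ℕ} (hm : m ∈ N.smoothNumbers) :
    torusChar m ∈ smoothAlgebra N :=
  Algebra.subset_adjoin ⟨m, hm, rfl⟩

/-! ### The reproducing kernel of finitely many variables -/

section Kernel

variable (N : ℕ) (s : ℂ)

/-- The reproducing kernel of the Hardy space in the variables `χ_q`, `q < N`. -/
def kernel : C(Polytorus, ℂ) :=
  ∑' m : N.smoothNumbers, conj (((m : ℕ) : ℂ) ^ (-s)) • torusChar m

/-- The functional `g ↦ ∫ g k̄`. -/
def kernelFunctional : C(Polytorus, ℂ) →L[ℂ] ℂ :=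
  haarIntegral.comp ((ContinuousLinearMap.mul ℂ C(Polytorus, ℂ)).flip (star (kernel N s)))

lemma kernelFunctional_apply (g : C(Polytorus, ℂ)) :
    kernelFunctional N s g = haarIntegral (g * star (kernel N s)) := rfl

variable {s}

lemma norm_prime_cpow_lt_one (hs : 0 < s.re) {q : ℕ} (hq : q.Prime) :
    ‖(q : ℂ) ^ (-s)‖ < 1 := by
  rw [Complex.norm_natCast_cpow_of_pos hq.pos]
  exact Real.rpow_lt_one_of_one_lt_of_neg (by exact_mod_cast hq.one_lt) (by simpa using hs)

/-- The completely multiplicative function `n ↦ conj(n^{-s}) χ(n)`. -/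
def kernelHom (hs : 0 < s.re) (χ : Polytorus) : ℕ →* ℂ where
  toFun n := conj ((n : ℂ) ^ (-s)) * (charValue χ n : ℂ)
  map_one' := by simp [charValue_one]
  map_mul' m n := by
    have hs0 : -s ≠ 0 := by rintro h; simp [neg_eq_zero.1 h] at hs
    rcases eq_or_ne m 0 with rfl | hm
    · simp [Complex.zero_cpow hs0]
    rcases eq_or_ne n 0 with rfl | hn
    · simp [Complex.zero_cpow hs0]
    rw [charValue_mul_right χ hm hn, Nat.cast_mul, Complex.natCast_mul_natCast_cpow]
    simp only [map_mul, Circle.coe_mul]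
    ring

lemma kernelHom_apply (hs : 0 < s.re) (χ : Polytorus) (n : ℕ) :
    kernelHom hs χ n = conj ((n : ℂ) ^ (-s)) * (charValue χ n : ℂ) := rfl

lemma norm_kernelHom (hs : 0 < s.re) (χ : Polytorus) (n : ℕ) :
    ‖kernelHom hs χ n‖ = ‖(n : ℂ) ^ (-s)‖ := by
  rw [kernelHom_apply, norm_mul, Circle.norm_coe, mul_one, RCLike.norm_conj]

lemma kernelHom_euler (hs : 0 < s.re) (χ : Polytorus) :
    Summable (fun m : N.smoothNumbers => ‖kernelHom hs χ m‖) ∧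
      HasSum (fun m : N.smoothNumbers => kernelHom hs χ m)
        (∏ q ∈ N.primesBelow, (1 - kernelHom hs χ q)⁻¹) :=
  EulerProduct.summable_and_hasSum_smoothNumbers_prod_primesBelow_geometric
    (fun {q} hq => by rw [norm_kernelHom]; exact norm_prime_cpow_lt_one hs hq) N

/-- With finitely many primes the Euler product converges absolutely already for Re s > 0. The norms
|m^{-s}| do not depend on χ, so the convergence is uniform on the polytorus. -/
lemma hasSum_kernel (hs : 0 < s.re) :
    HasSum (fun m : N.smoothNumbers => conj (((m : ℕ) : ℂ) ^ (-s)) • torusChar m)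
      (kernel N s) := by
  refine (Summable.of_norm_bounded (kernelHom_euler N hs 1).1 fun m => ?_).hasSum
  rw [norm_smul, norm_kernelHom, RCLike.norm_conj]
  exact mul_le_of_le_one_right (norm_nonneg _) (norm_torusChar_le _)

lemma kernel_apply (hs : 0 < s.re) (χ : Polytorus) :
    kernel N s χ = ∏ q ∈ N.primesBelow, (1 - kernelHom hs χ q)⁻¹ := by
  refine HasSum.unique ?_ (kernelHom_euler N hs χ).2
  simpa [kernelHom_apply] using (hasSum_kernel N hs).mapL (ContinuousMap.evalCLM ℂ χ)

/-- The reproducing property: integrating the series of k̄ term by term, orthogonality of the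
characters leaves only the term n = m. -/
lemma kernelFunctional_torusChar (hs : 0 < s.re) {m : ℕ} (hm : m ∈ N.smoothNumbers) :
    kernelFunctional N s (torusChar m) = (m : ℂ) ^ (-s) := by
  have h := ((hasSum_kernel N hs).star).mapL
    (haarIntegral.comp (ContinuousLinearMap.mul ℂ C(Polytorus, ℂ) (torusChar m)))
  refine h.unique ?_
  have key : ∀ n : N.smoothNumbers,
      haarIntegral.comp (ContinuousLinearMap.mul ℂ C(Polytorus, ℂ) (torusChar m))
        (star (conj (((n : ℕ) : ℂ) ^ (-s)) • torusChar n))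
        = if n = ⟨m, hm⟩ then (m : ℂ) ^ (-s) else 0 := by
    intro n
    have := haarIntegral_torusChar_mul_star (Nat.ne_zero_of_mem_smoothNumbers hm)
      (Nat.ne_zero_of_mem_smoothNumbers n.2)
    simp only [star_smul, map_smul, ContinuousLinearMap.comp_apply, ContinuousLinearMap.mul_apply',
      this, Subtype.ext_iff, smul_eq_mul, eq_comm (a := m)]
    split_ifs with h
    · simp [h]
    · simp
  simp only [key]
  exact hasSum_ite_eq _ _

lemma kernelFunctional_one (hs : 0 < s.re) : kernelFunctional N s 1 = 1 := by
  have := kernelFunctional_torusChar N hs (one_mem_smoothNumbers N)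
  simpa [torusChar_one] using this

/-- On characters this is the complete multiplicativity of m ↦ m^{-s}; linearity and continuity do
the rest. -/
lemma kernelFunctional_mul (hs : 0 < s.re) {x y : C(Polytorus, ℂ)}
    (hx : x ∈ (smoothAlgebra N).topologicalClosure)
    (hy : y ∈ (smoothAlgebra N).topologicalClosure) :
    kernelFunctional N s (x * y) = kernelFunctional N s x * kernelFunctional N s y := by
  refine map_mul_of_mem_closure_adjoin (smoothChars N) _ ?_ hx hy
  rintro _ ⟨m, hm, rfl⟩ _ ⟨n, hn, rfl⟩
  rw [← torusChar_mul (Nat.ne_zero_of_mem_smoothNumbers hm)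
    (Nat.ne_zero_of_mem_smoothNumbers hn), kernelFunctional_torusChar N hs hm,
    kernelFunctional_torusChar N hs hn,
    kernelFunctional_torusChar N hs (Nat.mul_mem_smoothNumbers hm hn), Nat.cast_mul,
    Complex.natCast_mul_natCast_cpow]

/-- The kernel has a logarithm in the closed algebra generated by the variables. -/
lemma exists_exp_eq_kernel (hs : 0 < s.re) :
    ∃ h ∈ (smoothAlgebra N).topologicalClosure, NormedSpace.exp h = kernel N s := by
  have key : ∀ q ∈ N.primesBelow, ∃ h ∈ (smoothAlgebra N).topologicalClosure,
      ∀ χ, Complex.exp (h χ) = (1 - kernelHom hs χ q)⁻¹ := by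
    intro q hq
    have hqp := Nat.prime_of_mem_primesBelow hq
    have hqN : q ∈ N.smoothNumbers := by
      refine Nat.mem_smoothNumbers'.2 fun r hr hrq => ?_
      rw [(Nat.prime_dvd_prime_iff_eq hr hqp).1 hrq]
      exact Nat.lt_of_mem_primesBelow hq
    set w : C(Polytorus, ℂ) := conj ((q : ℂ) ^ (-s)) • torusChar q with hw
    have hwn : ‖w‖ < 1 := by
      refine lt_of_le_of_lt ?_ (norm_prime_cpow_lt_one hs hqp)
      rw [hw, norm_smul, RCLike.norm_conj]
      exact mul_le_of_le_one_right (norm_nonneg _) (norm_torusChar_le _)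
    have hwm : w ∈ (smoothAlgebra N).topologicalClosure :=
      Subalgebra.smul_mem _ (Subalgebra.le_topologicalClosure _
        (torusChar_mem_smoothAlgebra hqN)) _
    -- The series of -log(1 - w), one prime at a time; its j = 0 term vanishes because 0⁻¹ = 0.
    have hsum : Summable fun j : ℕ => ((j : ℂ)⁻¹) • w ^ j := by
      refine Summable.of_norm_bounded (summable_geometric_of_lt_one (norm_nonneg w) hwn)
        fun j => ?_
      rw [norm_smul, norm_inv, Complex.norm_natCast]
      refine (mul_le_of_le_one_left (norm_nonneg _) (Nat.cast_inv_le_one j)).trans (norm_pow_le _ _)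
    refine ⟨∑' j : ℕ, ((j : ℂ)⁻¹) • w ^ j, tsum_mem
      (smoothAlgebra N).isClosed_topologicalClosure
      fun j => Subalgebra.smul_mem _ (pow_mem hwm j) _, fun χ => ?_⟩
    have hwχ : w χ = kernelHom hs χ q := rfl
    have hlt : ‖kernelHom hs χ q‖ < 1 := by
      rw [norm_kernelHom]; exact norm_prime_cpow_lt_one hs hqp
    have e1 := hsum.hasSum.mapL (ContinuousMap.evalCLM ℂ χ)
    have e2 := Complex.hasSum_taylorSeries_neg_log hlt
    have e3 : (∑' j : ℕ, ((j : ℂ)⁻¹) • w ^ j : C(Polytorus, ℂ)) χ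
        = -Complex.log (1 - kernelHom hs χ q) := by
      refine HasSum.unique (by simpa using e1) ?_
      simpa [hwχ, div_eq_inv_mul] using e2
    rw [e3, Complex.exp_neg, Complex.exp_log]
    intro h0
    rw [sub_eq_zero] at h0
    rw [← h0] at hlt
    simp at hlt
  choose! h hmem hexp using key
  refine ⟨∑ q ∈ N.primesBelow, h q, sum_mem hmem, ?_⟩
  ext χ
  rw [exp_continuousMap_apply, kernel_apply N hs, ContinuousMap.sum_apply, Complex.exp_sum]
  exact Finset.prod_congr rfl fun q hq => hexp q hq χ

end Kernel

/-! ### Point evaluations on Hardy spaces -/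

/-- Comparison with an integral: ζ(x) ≤ 1 + ∫₁^∞ t^{-x} dt = x/(x - 1). -/
lemma sum_range_rpow_neg_le {x : ℝ} (hx : 1 < x) (N : ℕ) :
    ∑ n ∈ Finset.range N, ((n + 1 : ℕ) : ℝ) ^ (-x) ≤ x / (x - 1) := by
  have hx1 : 0 < x - 1 := by linarith
  cases N with
  | zero => simp; positivity
  | succ N =>
    have hanti : AntitoneOn (fun t : ℝ => t ^ (-x)) (Icc (1 : ℝ) (1 + N)) := by
      intro a ha b hb hab
      exact Real.rpow_le_rpow_of_nonpos (by linarith [ha.1]) hab (by linarith)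
    have h1 := hanti.sum_le_integral
    rw [integral_rpow (Or.inr ⟨by linarith, by
      rw [uIcc_of_le (by simp)]; rintro ⟨h, _⟩; linarith⟩)] at h1
    rw [Finset.sum_range_succ']
    have h2 : ∑ n ∈ Finset.range N, ((n + 1 + 1 : ℕ) : ℝ) ^ (-x)
        = ∑ i ∈ Finset.range N, (1 + ((i + 1 : ℕ) : ℝ)) ^ (-x) :=
      Finset.sum_congr rfl fun i _ => by congr 1; push_cast; ring
    have h3 : ((1 + (N : ℝ)) ^ (-x + 1) - 1 ^ (-x + 1)) / (-x + 1) ≤ 1 / (x - 1) := by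
      have h4 : 0 ≤ (1 + (N : ℝ)) ^ (-x + 1) := by positivity
      rw [Real.one_rpow, ← neg_div_neg_eq, div_le_div_iff₀ (by linarith) hx1]
      nlinarith
    have h5 : x / (x - 1) = 1 / (x - 1) + 1 := by field_simp; ring
    rw [h2, h5]
    simpa using h1.trans h3

lemma sum_rpow_neg_le {x : ℝ} (hx : 1 < x) (S : Finset ℕ) (hS : 0 ∉ S) :
    ∑ n ∈ S, (n : ℝ) ^ (-x) ≤ x / (x - 1) := by
  refine le_trans ?_ (sum_range_rpow_neg_le hx (S.sup id))
  have : ∑ n ∈ Finset.range (S.sup id), ((n + 1 : ℕ) : ℝ) ^ (-x)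
      = ∑ n ∈ (Finset.range (S.sup id)).image (fun i : ℕ => i + 1),
        (n : ℝ) ^ (-x) := by
    rw [Finset.sum_image fun a _ b _ h => Nat.succ_injective h]
  rw [this]
  refine Finset.sum_le_sum_of_subset_of_nonneg (fun n hn => ?_) fun _ _ _ => by positivity
  have h0 : n ≠ 0 := fun h => hS (h ▸ hn)
  have h1 : n ≤ S.sup id := Finset.le_sup (f := id) hn
  exact Finset.mem_image.2 ⟨n - 1, Finset.mem_range.2 (by omega), by omega⟩

lemma integral_norm_sq_kernel (N : ℕ) (s : ℂ) :
    kernelFunctional N s (kernel N s)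
      = ((∫ χ, ‖kernel N s χ‖ ^ (2 : ℝ) ∂haarPolytorus : ℝ) : ℂ) := by
  rw [kernelFunctional_apply, haarIntegral_apply, ← integral_complex_ofReal]
  refine integral_congr_ae (.of_forall fun χ => ?_)
  simp [RCLike.mul_conj]

/-- Applying the functional to the series of k gives the sum of |m^{-s}|² = m^{-2 Re s} over smooth
m, part of ζ(2 Re s). -/
lemma norm_kernelFunctional_kernel_le (N : ℕ) {s : ℂ} (hs : 1 / 2 < s.re) :
    ‖kernelFunctional N s (kernel N s)‖ ≤ 2 * s.re / (2 * s.re - 1) := by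
  have h0 : 0 < s.re := by linarith
  have h := ((hasSum_kernel N h0).mapL (kernelFunctional N s)).norm
  refine le_of_tendsto h (.of_forall fun S => ?_)
  refine (norm_sum_le _ _).trans ?_
  refine le_trans (le_of_eq ?_) (sum_rpow_neg_le (x := 2 * s.re) (by linarith)
    (S.map (Function.Embedding.subtype _)) ?_)
  · rw [Finset.sum_map]
    refine Finset.sum_congr rfl fun m _ => ?_
    have hm : 0 < (m : ℕ) := Nat.pos_of_ne_zero (Nat.ne_zero_of_mem_smoothNumbers m.2)
    rw [map_smul, kernelFunctional_torusChar N h0 m.2, norm_smul, RCLike.norm_conj,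
      Complex.norm_natCast_cpow_of_pos hm, ← Real.rpow_add (by exact_mod_cast hm)]
    simp only [Complex.neg_re, Function.Embedding.subtype_apply]
    congr 1; ring
  · simp only [Finset.mem_map, Function.Embedding.subtype_apply, not_exists, not_and]
    exact fun m _ h => Nat.ne_zero_of_mem_smoothNumbers m.2 h

/-- Hölder's inequality: the exponent 2 - 2/p is 2/q with q conjugate to p. For p = 1 the power of k
is trivial. -/
lemma integral_mul_rpow_le {p : ℝ} (hp : 1 ≤ p) (f k : C(Polytorus, ℂ)) :
    ∫ χ, ‖f χ‖ * ‖k χ‖ ^ (2 - 2 / p) ∂haarPolytorus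
      ≤ (∫ χ, ‖f χ‖ ^ p ∂haarPolytorus) ^ (1 / p)
        * (∫ χ, ‖k χ‖ ^ (2 : ℝ) ∂haarPolytorus) ^ (1 - 1 / p) := by
  rcases hp.eq_or_lt with rfl | hp1
  · norm_num
  have hc := Real.HolderConjugate.conjExponent hp1
  set q := p.conjExponent with hq
  have hp0 : 0 < p := by linarith
  have he : 0 ≤ 2 - 2 / p := by
    have : 2 / p ≤ 2 := div_le_self (by norm_num) hp
    linarith
  have hq1 : 1 / q = 1 - 1 / p := by
    have := hc.inv_add_inv_eq_one
    simp only [one_div]; linarith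
  have hcf : Continuous fun χ => ‖f χ‖ := f.continuous.norm
  have hck : Continuous fun χ => ‖k χ‖ ^ (2 - 2 / p) :=
    k.continuous.norm.rpow_const fun _ => Or.inr he
  have h := integral_mul_le_Lp_mul_Lq_of_nonneg (μ := haarPolytorus) hc
    (f := fun χ => ‖f χ‖) (g := fun χ => ‖k χ‖ ^ (2 - 2 / p))
    (.of_forall fun _ => norm_nonneg _)
    (.of_forall fun _ => by positivity)
    (hcf.memLp_of_hasCompactSupport (HasCompactSupport.of_compactSpace _))
    (hck.memLp_of_hasCompactSupport (HasCompactSupport.of_compactSpace _))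
  have hexp : (2 - 2 / p) * q = 2 := by
    have h1 : 2 - 2 / p = 2 * (1 / q) := by rw [hq1]; ring
    rw [h1, mul_assoc, one_div_mul_cancel hc.symm.ne_zero, mul_one]
  simp only [← Real.rpow_mul (norm_nonneg _), hexp, hq1] at h
  exact h

/-- The case p = 2 is Cauchy–Schwarz against k; inserting the analytic factor k^{1-2/p} transfers it
to all p ≥ 1. -/
theorem norm_evalPoly_le_hardyNorm {p : ℝ} (hp : 1 ≤ p) {s : ℂ} (hs : 1 / 2 < s.re)
    (P : DirichletPoly) :
    ‖evalPoly s P‖ ≤ (2 * s.re / (2 * s.re - 1)) ^ (1 / p) * hardyNorm p P := by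
  have hp0 : 0 < p := by linarith
  have h0 : 0 < s.re := by linarith
  obtain ⟨N, hN⟩ : ∃ N : ℕ, ∀ n ∈ P.support, (n : ℕ) ∈ N.smoothNumbers := by
    -- The +1 is needed because the primes dividing an N-smooth number are strictly below N.
    refine ⟨P.support.sup (fun n => (n : ℕ)) + 1, fun n hn => Nat.mem_smoothNumbers'.2
      fun q _ hq => ?_⟩
    exact Nat.lt_succ_of_le ((Nat.le_of_dvd n.pos hq).trans
      (Finset.le_sup (f := fun n : ℕ+ => (n : ℕ)) hn))
  set Φ := kernelFunctional N s with hΦ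
  set f : C(Polytorus, ℂ) := ∑ n ∈ P.support, P n • torusChar n with hf
  have hfχ : ∀ χ, f χ = bohrLift P χ := fun χ => by
    simp [hf, bohrLift, Finsupp.sum, ContinuousMap.sum_apply]
  have hfm : f ∈ (smoothAlgebra N).topologicalClosure :=
    sum_mem fun n hn => Subalgebra.smul_mem _
      (Subalgebra.le_topologicalClosure _ (torusChar_mem_smoothAlgebra (hN n hn))) _
  have hΦf : Φ f = evalPoly s P := by
    rw [hf, map_sum, evalPoly_apply, Finsupp.sum]
    exact Finset.sum_congr rfl fun n hn => by
      rw [map_smul, hΦ, kernelFunctional_torusChar N h0 (hN n hn), smul_eq_mul]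
  obtain ⟨h, hm, hk⟩ := exists_exp_eq_kernel N h0
  set k := kernel N s with hkdef
  have hexp : ∀ {x}, x ∈ (smoothAlgebra N).topologicalClosure →
      Φ (NormedSpace.exp x) = Complex.exp (Φ x) := fun {x} hx =>
    map_exp_of_mul (smoothAlgebra N).topologicalClosure Φ (kernelFunctional_one N h0)
      (fun x hx y hy => kernelFunctional_mul N h0 hx hy) hx
  -- Chosen so that |k^a| |k| = |k|^{2-2/p}, as Hölder requires. It is negative for p < 2 and in
  -- general not an integer, whence the logarithm h.
  set a : ℝ := 1 - 2 / p with ha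
  set K : ℝ := ∫ χ, ‖k χ‖ ^ (2 : ℝ) ∂haarPolytorus with hK
  have hK0 : 0 ≤ K := integral_nonneg fun χ => by positivity
  have hΦk : ‖Φ k‖ = K := by
    rw [hΦ, hkdef, integral_norm_sq_kernel, Complex.norm_real, Real.norm_of_nonneg hK0]
  have hKexp : K = Real.exp (Φ h).re := by
    rw [← hΦk, ← hk, hexp hm, Complex.norm_exp]
  have hKpos : 0 < K := hKexp ▸ Real.exp_pos _
  have hKle : K ≤ 2 * s.re / (2 * s.re - 1) := hΦk ▸ norm_kernelFunctional_kernel_le N hs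
  have ham : (a : ℂ) • h ∈ (smoothAlgebra N).topologicalClosure := Subalgebra.smul_mem _ hm _
  have hEm : NormedSpace.exp ((a : ℂ) • h) ∈ (smoothAlgebra N).topologicalClosure :=
    exp_mem_of_isClosed _ (smoothAlgebra N).isClosed_topologicalClosure ham
  -- As a is real and K = exp(Re Φ(h)), |Φ(exp(a h))| = exp(a Re Φ(h)) = K^a.
  have hlhs : ‖Φ (f * NormedSpace.exp ((a : ℂ) • h))‖ = ‖evalPoly s P‖ * K ^ a := by
    rw [hΦ, kernelFunctional_mul N h0 hfm hEm, ← hΦ, hexp ham, hΦf, norm_mul, map_smul,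
      Complex.norm_exp, hKexp, ← Real.exp_mul]
    simp [mul_comm]
  have hkχ : ∀ χ, ‖NormedSpace.exp ((a : ℂ) • h) χ‖ * ‖k χ‖ = ‖k χ‖ ^ (2 - 2 / p) := fun χ => by
    have h1 : ‖k χ‖ = Real.exp (h χ).re := by
      rw [← hk, exp_continuousMap_apply, Complex.norm_exp]
    have h2 : (2 : ℝ) - 2 / p = a + 1 := by rw [ha]; ring
    rw [exp_continuousMap_apply, Complex.norm_exp, h1, ← Real.exp_mul, ← Real.exp_add, h2]
    congr 1
    simp
    ring
  have hrhs : ‖Φ (f * NormedSpace.exp ((a : ℂ) • h))‖ ≤ hardyNorm p P * K ^ (1 - 1 / p) := by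
    rw [hΦ, kernelFunctional_apply, haarIntegral_apply]
    refine (norm_integral_le_integral_norm _).trans ?_
    have h1 := integral_mul_rpow_le hp f k
    simp only [← hkχ, hfχ] at h1
    rw [hardyNorm]
    refine le_of_eq_of_le (integral_congr_ae (.of_forall fun χ => ?_)) h1
    simp [hfχ, mul_assoc, hkdef]
  have hmain : ‖evalPoly s P‖ ≤ hardyNorm p P * K ^ (1 / p) := by
    have h1 : K ^ (1 - 1 / p) = K ^ (1 / p) * K ^ a := by
      rw [← Real.rpow_add hKpos, ha]
      congr 1; ring
    rw [hlhs, h1, ← mul_assoc] at hrhs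
    exact le_of_mul_le_mul_right hrhs (by positivity)
  rw [mul_comm]
  exact hmain.trans (mul_le_mul_of_nonneg_left
    (Real.rpow_le_rpow hK0 hKle (by positivity)) (hardyNorm_nonneg _ _))

/-! ### Point evaluations on Bergman spaces -/

lemma evalPoly_translate (η : ℝ) (s : ℂ) (P : DirichletPoly) :
    evalPoly (s - η) (translate η P) = evalPoly s P := by
  simp only [evalPoly_apply]
  unfold translate
  rw [Finsupp.onFinset_sum _ (by simp), Finsupp.sum]
  refine Finset.sum_congr rfl fun n _ => ?_
  rw [mul_assoc, ← Complex.cpow_add _ _ (by exact_mod_cast n.ne_zero)]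
  congr 2; ring

lemma bergmanNorm_rpow {p : ℝ} (hp : 1 ≤ p) (α : ℝ) (P : DirichletPoly) :
    bergmanNorm p (muAlpha α) P ^ p = ∫ σ, hardyNorm p (translate σ P) ^ p ∂muAlpha α := by
  rw [bergmanNorm, muAlpha_restrict, one_div, Real.rpow_inv_rpow
    (integral_nonneg fun σ => Real.rpow_nonneg (hardyNorm_nonneg _ _) _) (by linarith)]

lemma integrable_hardyNorm_rpow {p : ℝ} (hp : 1 ≤ p) {α : ℝ} (hα : -1 < α) (P : DirichletPoly) :
    Integrable (fun σ => hardyNorm p (translate σ P) ^ p) (muAlpha α) := by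
  have h := (memLp_hardyNorm_translate hp hα (ENNReal.ofReal p) P).integrable_norm_rpow
    (by simp; linarith) (by simp)
  simpa [ENNReal.toReal_ofReal (by linarith : 0 ≤ p), Real.norm_of_nonneg (hardyNorm_nonneg _ _)]
    using h

/-- On (0, 1] the factor e^{-2σ} is at least e^{-2}, and σ^α integrates to t^{α+1}/(α+1). -/
lemma exists_le_muAlpha {α : ℝ} (hα : -1 < α) :
    ∃ c : ℝ, 0 < c ∧ ∀ t : ℝ, 0 < t → t ≤ 1 →
      c * t ^ (α + 1) ≤ (muAlpha α).real (Ioc 0 t) := by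
  have ha : 0 < α + 1 := by linarith
  have hG := Real.Gamma_pos_of_pos ha
  have := isProbabilityMeasure_muAlpha hα
  set b : ℝ := 2 ^ (α + 1) / Real.Gamma (α + 1) * Real.exp (-2) with hb
  have hb0 : 0 < b := by positivity
  refine ⟨b / (α + 1), by positivity, fun t ht ht1 => ?_⟩
  have hint : ∫ σ in Ioc 0 t, b * σ ^ α = b / (α + 1) * t ^ (α + 1) := by
    rw [← intervalIntegral.integral_of_le ht.le, intervalIntegral.integral_const_mul,
      integral_rpow (Or.inl hα), Real.zero_rpow ha.ne']
    ring
  have hi : IntegrableOn (fun σ : ℝ => b * σ ^ α) (Ioc 0 t) :=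
    (intervalIntegrable_iff_integrableOn_Ioc_of_le ht.le).1
      ((intervalIntegral.intervalIntegrable_rpow' hα).const_mul b)
  rw [Measure.real, ← ENNReal.ofReal_le_iff_le_toReal (measure_ne_top _ _), ← hint,
    ofReal_integral_eq_lintegral_ofReal hi]
  · rw [muAlpha, withDensity_apply _ measurableSet_Ioc, Measure.restrict_restrict measurableSet_Ioc,
      inter_eq_left.2 Ioc_subset_Ioi_self]
    refine setLIntegral_mono' measurableSet_Ioc fun σ hσ => ENNReal.ofReal_le_ofReal ?_
    have hσ0 : 0 < σ := hσ.1
    have he : Real.exp (-2) ≤ Real.exp (-2 * σ) := Real.exp_le_exp.2 (by linarith [hσ.2])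
    have h1 : 0 ≤ 2 ^ (α + 1) / Real.Gamma (α + 1) * σ ^ α := by positivity
    calc b * σ ^ α = 2 ^ (α + 1) / Real.Gamma (α + 1) * σ ^ α * Real.exp (-2) := by rw [hb]; ring
      _ ≤ _ := mul_le_mul_of_nonneg_left he h1
  · filter_upwards [self_mem_ae_restrict measurableSet_Ioc] with σ hσ
    have : 0 < σ := hσ.1
    positivity

/-- A quantity controlled by the Hardy norms of the translates `P_η`, `0 < η ≤ t`, is controlled
by the Bergman norm. -/
lemma rpow_mul_le_of_le_hardyNorm {p : ℝ} (hp : 1 ≤ p) {α : ℝ} (hα : -1 < α) (P : DirichletPoly)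
    {t A C : ℝ} (hA : 0 ≤ A) (hC : 0 ≤ C)
    (h : ∀ η ∈ Ioc 0 t, A ≤ C * hardyNorm p (translate η P)) :
    A ^ p * (muAlpha α).real (Ioc 0 t) ≤ C ^ p * bergmanNorm p (muAlpha α) P ^ p := by
  have := isProbabilityMeasure_muAlpha hα
  have hi := (integrable_hardyNorm_rpow hp hα P).const_mul (C ^ p)
  rw [bergmanNorm_rpow hp, ← integral_const_mul]
  calc A ^ p * (muAlpha α).real (Ioc 0 t) = ∫ _ in Ioc 0 t, A ^ p ∂muAlpha α := by
        rw [setIntegral_const, smul_eq_mul, mul_comm]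
    _ ≤ ∫ σ in Ioc 0 t, C ^ p * hardyNorm p (translate σ P) ^ p ∂muAlpha α := by
        refine setIntegral_mono_on (integrable_const _) hi.integrableOn measurableSet_Ioc
          fun η hη => ?_
        rw [← Real.mul_rpow hC (hardyNorm_nonneg _ _)]
        exact Real.rpow_le_rpow hA (h η hη) (by linarith)
    _ ≤ _ := setIntegral_le_integral hi (.of_forall fun σ =>
        mul_nonneg (Real.rpow_nonneg hC _) (Real.rpow_nonneg (hardyNorm_nonneg _ _) _))

/-- With R = Re s/(2 Re s - 1), the Hardy estimate at s - η costs R, and dividing by μ_α((0,t])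
costs R^{α+1}, since 1/t = O(R). -/
lemma exists_norm_evalPoly_le {p : ℝ} (hp : 1 ≤ p) {α : ℝ} (hα : -1 < α) :
    ∃ c : ℝ, 0 < c ∧ ∀ s : ℂ, 1 / 2 < s.re → ∀ P : DirichletPoly,
      ‖evalPoly s P‖
        ≤ c * (s.re / (2 * s.re - 1)) ^ ((2 + α) / p) * bergmanNorm p (muAlpha α) P := by
  have hp0 : 0 < p := by linarith
  have ha : 0 < α + 1 := by linarith
  obtain ⟨c, hc, hμ⟩ := exists_le_muAlpha hα
  -- The 4 comes from the Hardy constant being at most 4R at s - η, the 8 from 1/t ≤ 8R.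
  refine ⟨(4 * 8 ^ (α + 1) / c) ^ (1 / p), by positivity, fun s hs P => ?_⟩
  set δ := s.re - 1 / 2 with hδ
  have hδ0 : 0 < δ := by linarith
  set R := s.re / (2 * s.re - 1) with hR
  have hRδ : R = 1 / 2 + 1 / (4 * δ) := by
    have h1 : s.re = δ + 1 / 2 := by ring
    rw [hR, h1, show 2 * (δ + 1 / 2) - 1 = 2 * δ by ring]
    field_simp
    ring
  have hR0 : 0 < R := by rw [hRδ]; positivity
  -- The bound δ/2 keeps s - η at distance at least δ/2 from the critical line; the bound 1 is the
  -- range of the lower estimate for μ_α.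
  set t := min 1 (δ / 2) with ht
  have ht0 : 0 < t := lt_min one_pos (by positivity)
  have htR : 1 ≤ 8 * R * t := by
    have h1 : 0 < 1 / (4 * δ) := by positivity
    have h2 : 1 / (4 * δ) * (δ / 2) = 1 / 8 := by field_simp; norm_num
    rcases min_choice 1 (δ / 2) with h | h <;> rw [ht, h, hRδ] <;> nlinarith
  have hZ : ∀ η ∈ Ioc 0 t,
      ‖evalPoly s P‖ ≤ (4 * R) ^ (1 / p) * hardyNorm p (translate η P) := by
    intro η hη
    have hη1 : η ≤ δ / 2 := hη.2.trans (min_le_right _ _)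
    have hre : (s - (η : ℂ)).re = s.re - η := by simp
    have h1 := norm_evalPoly_le_hardyNorm hp (s := s - η) (by rw [hre]; linarith)
      (translate η P)
    rw [evalPoly_translate, hre] at h1
    refine h1.trans (mul_le_mul_of_nonneg_right (Real.rpow_le_rpow ?_ ?_ (by positivity))
      (hardyNorm_nonneg _ _))
    · exact div_nonneg (by linarith) (by linarith)
    · have h2 : 4 * R = 2 + 1 / δ := by rw [hRδ]; field_simp; ring
      have h3 : 0 < 2 * (s.re - η) - 1 := by linarith
      have h4 : 2 * (s.re - η) / (2 * (s.re - η) - 1) = 1 + 1 / (2 * (s.re - η) - 1) := by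
        field_simp; ring
      have h5 : 1 / (2 * (s.re - η) - 1) ≤ 1 / δ := one_div_le_one_div_of_le hδ0 (by linarith)
      rw [h2, h4]
      linarith
  have h1 := rpow_mul_le_of_le_hardyNorm hp hα P (norm_nonneg _) (by positivity) hZ
  have hB := bergmanNorm_nonneg p (muAlpha α) P
  set B := bergmanNorm p (muAlpha α) P
  rw [← Real.rpow_mul (by positivity), one_div_mul_cancel hp0.ne', Real.rpow_one] at h1
  have h2 : ‖evalPoly s P‖ ^ p ≤ (4 * 8 ^ (α + 1) / c) * R ^ (2 + α) * B ^ p := by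
    have h3 : 1 ≤ (8 * R) ^ (α + 1) * t ^ (α + 1) := by
      rw [← Real.mul_rpow (by positivity) ht0.le]
      exact Real.one_le_rpow htR ha.le
    have h4 : R ^ (2 + α) = R * R ^ (α + 1) := by
      rw [show 2 + α = 1 + (α + 1) by ring, Real.rpow_add hR0, Real.rpow_one]
    have h5 : c ≤ (8 * R) ^ (α + 1) * (muAlpha α).real (Ioc 0 t) := by
      have := mul_le_mul_of_nonneg_left (hμ t ht0 (min_le_left _ _))
        (show 0 ≤ (8 * R) ^ (α + 1) by positivity)
      nlinarith
    rw [h4, div_mul_eq_mul_div, div_mul_eq_mul_div, le_div_iff₀ hc]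
    calc ‖evalPoly s P‖ ^ p * c
        ≤ ‖evalPoly s P‖ ^ p * ((8 * R) ^ (α + 1) * (muAlpha α).real (Ioc 0 t)) :=
          mul_le_mul_of_nonneg_left h5 (by positivity)
      _ = (8 * R) ^ (α + 1) * (‖evalPoly s P‖ ^ p * (muAlpha α).real (Ioc 0 t)) := by ring
      _ ≤ (8 * R) ^ (α + 1) * (4 * R * B ^ p) := mul_le_mul_of_nonneg_left h1 (by positivity)
      _ = _ := by rw [Real.mul_rpow (by norm_num) hR0.le]; ring
  have h6 : ((4 * 8 ^ (α + 1) / c) ^ (1 / p) * R ^ ((2 + α) / p) * B) ^ p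
      = (4 * 8 ^ (α + 1) / c) * R ^ (2 + α) * B ^ p := by
    rw [Real.mul_rpow (by positivity) hB, Real.mul_rpow (by positivity) (by positivity),
      ← Real.rpow_mul (by positivity), ← Real.rpow_mul hR0.le, one_div_mul_cancel hp0.ne',
      div_mul_cancel₀ _ hp0.ne', Real.rpow_one]
  rw [← h6] at h2
  exact (Real.rpow_le_rpow_iff (norm_nonneg _) (by positivity) hp0).1 h2

/-! ### Decay of P(s) - a₁ for large Re s -/

/-- For 0 < η ≤ 1 one has |a_n|/n ≤ |a_n| n^{-η} ≤ ‖P_η‖_{𝓗^p}; average over η. The crude factor n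
is harmless when Re s is large. -/
lemma exists_norm_coeff_le {p : ℝ} (hp : 1 ≤ p) {α : ℝ} (hα : -1 < α) :
    ∃ c : ℝ, 0 < c ∧ ∀ (P : DirichletPoly) (n : ℕ+),
      ‖P n‖ ≤ c * n * bergmanNorm p (muAlpha α) P := by
  have hp0 : 0 < p := by linarith
  obtain ⟨c, hc, hμ⟩ := exists_le_muAlpha hα
  refine ⟨(1 / c) ^ (1 / p), by positivity, fun P n => ?_⟩
  have hn : (1 : ℝ) ≤ (n : ℕ) := by exact_mod_cast n.pos
  have hn0 : (0 : ℝ) < (n : ℕ) := by linarith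
  have h1 := rpow_mul_le_of_le_hardyNorm hp hα P (norm_nonneg (P n)) hn0.le (t := 1)
    fun η hη => by
      have h2 := norm_coeff_le_hardyNorm hp (translate η P) n
      rw [translate_apply, norm_mul, Complex.norm_natCast_cpow_of_pos n.pos] at h2
      simp only [Complex.neg_re, Complex.ofReal_re] at h2
      have h3 : ((n : ℕ) : ℝ)⁻¹ ≤ ((n : ℕ) : ℝ) ^ (-η) := by
        rw [← Real.rpow_neg_one]
        exact Real.rpow_le_rpow_of_exponent_le hn (by linarith [hη.2])
      have h4 := (mul_le_mul_of_nonneg_left h3 (norm_nonneg (P n))).trans h2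
      rwa [← div_eq_mul_inv, div_le_iff₀' hn0] at h4
  have hB := bergmanNorm_nonneg p (muAlpha α) P
  set B := bergmanNorm p (muAlpha α) P
  have h5 := hμ 1 one_pos le_rfl
  rw [Real.one_rpow, mul_one] at h5
  refine (Real.rpow_le_rpow_iff (norm_nonneg _) (by positivity) hp0).1 ?_
  rw [Real.mul_rpow (by positivity) hB, Real.mul_rpow (by positivity) hn0.le,
    ← Real.rpow_mul (by positivity), one_div_mul_cancel hp0.ne', Real.rpow_one, mul_assoc,
    div_mul_eq_mul_div, one_mul, le_div_iff₀ hc]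
  exact (mul_le_mul_of_nonneg_left h5 (by positivity)).trans h1

lemma exists_norm_evalPoly_sub_le {p : ℝ} (hp : 1 ≤ p) {α : ℝ} (hα : -1 < α) :
    ∃ c : ℝ, 0 < c ∧ ∀ s : ℂ, 4 ≤ s.re → ∀ P : DirichletPoly,
      ‖evalPoly s P - P 1‖ ≤ c * 2 ^ (-s.re) * bergmanNorm p (muAlpha α) P := by
  obtain ⟨c, hc, hcoeff⟩ := exists_norm_coeff_le hp hα
  -- 32 = 2⁴ · 2: the 2⁴ from 2^{4 - Re s}, the 2 from bounding the sum of n^{-2}.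
  refine ⟨c * 32, by positivity, fun s hs P => ?_⟩
  have hB := bergmanNorm_nonneg p (muAlpha α) P
  set B := bergmanNorm p (muAlpha α) P
  have hsub : evalPoly s P - P 1 = ∑ n ∈ P.support.erase 1, P n * ((n : ℕ) : ℂ) ^ (-s) := by
    rw [evalPoly_apply, Finsupp.sum, sub_eq_iff_eq_add]
    by_cases h : (1 : ℕ+) ∈ P.support
    · rw [← Finset.sum_erase_add _ _ h]
      simp
    · rw [Finset.erase_eq_of_notMem h, Finsupp.notMem_support_iff.1 h, add_zero]
  have hterm : ∀ n ∈ P.support.erase 1, ‖P n * ((n : ℕ) : ℂ) ^ (-s)‖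
      ≤ c * B * 2 ^ (4 - s.re) * ((n : ℕ) : ℝ) ^ (-2 : ℝ) := by
    intro n hn
    have hn2 : (2 : ℝ) ≤ (n : ℕ) := by
      have h1 : (n : ℕ) ≠ 1 := fun h => (Finset.mem_erase.1 hn).1 (PNat.coe_injective h)
      have := n.pos
      exact_mod_cast (show 2 ≤ (n : ℕ) by omega)
    have hn0 : (0 : ℝ) < (n : ℕ) := by linarith
    rw [norm_mul, Complex.norm_natCast_cpow_of_pos n.pos, Complex.neg_re]
    calc ‖P n‖ * ((n : ℕ) : ℝ) ^ (-s.re)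
        ≤ (c * (n : ℕ) * B) * ((n : ℕ) : ℝ) ^ (-s.re) :=
          mul_le_mul_of_nonneg_right (hcoeff P n) (by positivity)
      _ = c * B * (((n : ℕ) : ℝ) ^ (1 : ℝ) * ((n : ℕ) : ℝ) ^ (-s.re)) := by
          rw [Real.rpow_one]; ring
      -- Since 4 - Re s ≤ 0, the first factor is largest at n = 2; the second keeps the sum
      -- convergent.
      _ = c * B * (((n : ℕ) : ℝ) ^ (4 - s.re) * ((n : ℕ) : ℝ) ^ (-3 : ℝ)) := by
          rw [← Real.rpow_add hn0, ← Real.rpow_add hn0]; congr 2; ring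
      _ ≤ c * B * (2 ^ (4 - s.re) * ((n : ℕ) : ℝ) ^ (-2 : ℝ)) := by
          refine mul_le_mul_of_nonneg_left ?_ (by positivity)
          exact mul_le_mul (Real.rpow_le_rpow_of_nonpos two_pos hn2 (by linarith))
            (Real.rpow_le_rpow_of_exponent_le (by linarith) (by norm_num))
            (by positivity) (by positivity)
      _ = _ := by ring
  have hsum : ∑ n ∈ P.support.erase 1, ((n : ℕ) : ℝ) ^ (-2 : ℝ) ≤ 2 := by
    have h := sum_rpow_neg_le (x := 2) (by norm_num)
      ((P.support.erase 1).map ⟨fun n : ℕ+ => (n : ℕ), PNat.coe_injective⟩) (by simp)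
    rw [Finset.sum_map] at h
    norm_num at h ⊢
    exact h
  rw [hsub]
  refine (norm_sum_le _ _).trans ((Finset.sum_le_sum hterm).trans ?_)
  rw [← Finset.mul_sum]
  refine (mul_le_mul_of_nonneg_left hsum (by positivity)).trans (le_of_eq ?_)
  rw [show 4 - s.re = 4 + -s.re by ring, Real.rpow_add two_pos]
  norm_num
  ring

/-- Raise y ≤ e^y, with y = x log 2/β, to the power β. -/
lemma exists_rpow_le_two_rpow {β : ℝ} (hβ : 0 < β) :
    ∃ M : ℝ, 0 < M ∧ ∀ x : ℝ, 0 < x → (2 * x) ^ β ≤ M * 2 ^ x := by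
  have hl : 0 < Real.log 2 := Real.log_pos one_lt_two
  refine ⟨(2 * β / Real.log 2) ^ β, by positivity, fun x hx => ?_⟩
  have h1 : 2 * x ≤ 2 * β / Real.log 2 * Real.exp (x * Real.log 2 / β) := by
    have h2 := (le_add_of_nonneg_right zero_le_one).trans
      (Real.add_one_le_exp (x * Real.log 2 / β))
    have h3 := mul_le_mul_of_nonneg_left h2 (show 0 ≤ 2 * β / Real.log 2 by positivity)
    refine le_of_eq_of_le ?_ h3
    field_simp
  refine (Real.rpow_le_rpow (by positivity) h1 hβ.le).trans (le_of_eq ?_)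
  rw [Real.mul_rpow (by positivity) (Real.exp_pos _).le, ← Real.exp_mul,
    Real.rpow_def_of_pos two_pos]
  congr 2
  field_simp

/-! ### Extension to the completion -/

section Extension

variable (p α : ℝ) [hp : Fact (1 ≤ p)] [hα : Fact (-1 < α)]

lemma bergmanSpace_induction {C : BergmanSpace p α → Prop} (hC : IsClosed {f | C f})
    (h : ∀ P : DirichletPoly, C (toBergman p α P)) (f : BergmanSpace p α) : C f :=
  UniformSpace.Completion.induction_on f hC fun P => h ((BergmanPoly.ofPoly p α).symm P)

lemma exists_isPointEvaluation {s : ℂ} {M : ℝ} (hM : 0 ≤ M)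
    (h : ∀ P : DirichletPoly, ‖evalPoly s P‖ ≤ M * bergmanNorm p (muAlpha α) P) :
    ∃ δ : BergmanSpace p α →L[ℂ] ℂ, IsPointEvaluation p α s δ ∧ ‖δ‖ ≤ M := by
  let e : BergmanPoly p α →L[ℂ] ℂ := LinearMap.mkContinuous
    (evalPoly s ∘ₗ (BergmanPoly.ofPoly p α).symm.toLinearMap) M
    fun P => h ((BergmanPoly.ofPoly p α).symm P)
  have hδ : IsPointEvaluation p α s (e.extend UniformSpace.Completion.toComplL) := fun P =>
    ContinuousLinearMap.extend_eq e
      (e := (UniformSpace.Completion.toComplL : BergmanPoly p α →L[ℂ] BergmanSpace p α))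
      UniformSpace.Completion.denseRange_coe
      (UniformSpace.Completion.isUniformInducing_coe _) (BergmanPoly.ofPoly p α P)
  refine ⟨_, hδ, ContinuousLinearMap.opNorm_le_bound _ hM fun f => ?_⟩
  refine bergmanSpace_induction p α (C := fun f => ‖e.extend _ f‖ ≤ M * ‖f‖)
    (isClosed_le (by fun_prop) (by fun_prop)) (fun P => ?_) f
  rw [hδ P, norm_toBergman]
  exact h P

/-- Estimating δ minus the constant coefficient on the whole space before restricting avoids having
to approximate elements of the subspace by polynomials without constant term. -/
lemma IsPointEvaluation.norm_restrict_le {s : ℂ} {δ : BergmanSpace p α →L[ℂ] ℂ}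
    (hδ : IsPointEvaluation p α s δ) {M : ℝ} (hM : 0 ≤ M)
    (h : ∀ P : DirichletPoly, ‖evalPoly s P - P 1‖ ≤ M * bergmanNorm p (muAlpha α) P) :
    ‖δ.comp (BergmanSpaceInfty p α).subtypeL‖ ≤ M := by
  have key : ∀ f : BergmanSpace p α, ‖δ f - constCoeff p α f‖ ≤ M * ‖f‖ := fun f => by
    refine bergmanSpace_induction p α (C := fun f => ‖δ f - constCoeff p α f‖ ≤ M * ‖f‖)
      (isClosed_le (by fun_prop) (by fun_prop)) (fun P => ?_) f
    rw [hδ P, constCoeff_toBergman, norm_toBergman]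
    exact h P
  refine ContinuousLinearMap.opNorm_le_bound _ hM fun f => ?_
  have hf : constCoeff p α f = 0 := f.2
  have := key f
  rwa [hf, sub_zero] at this

end Extension

end DirichletBergman

end

/-! ### The theorem -/

theorem mainTheorem2 (p α : ℝ) [Fact (1 ≤ p)] [Fact (-1 < α)] :
    ∃ δ : ℂ → (DirichletBergman.BergmanSpace p α →L[ℂ] ℂ),
      (∀ s : ℂ, 1 / 2 < s.re → DirichletBergman.IsPointEvaluation p α s (δ s)) ∧
      (∃ c : ℝ, 0 < c ∧ ∀ s : ℂ, 1 / 2 < s.re →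
        ‖δ s‖ ≤ c * (s.re / (2 * s.re - 1)) ^ ((2 + α) / p)) ∧
      (∃ c' : ℝ, 0 < c' ∧ ∀ s : ℂ, 1 / 2 < s.re →
        ‖(δ s).comp (DirichletBergman.BergmanSpaceInfty p α).subtypeL‖
          ≤ c' / (2 * s.re - 1) ^ ((2 + α) / p)) := by
  have hp : 1 ≤ p := Fact.out
  have hα : -1 < α := Fact.out
  obtain ⟨c, hc, hev⟩ := DirichletBergman.exists_norm_evalPoly_le hp hα
  obtain ⟨d, hd, hsub⟩ := DirichletBergman.exists_norm_evalPoly_sub_le hp hα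
  set β := (2 + α) / p with hβdef
  have hβ : 0 < β := div_pos (by linarith) (by linarith)
  obtain ⟨M, hM, htwo⟩ := DirichletBergman.exists_rpow_le_two_rpow hβ
  have hex : ∀ s : ℂ, ∃ δ : DirichletBergman.BergmanSpace p α →L[ℂ] ℂ, 1 / 2 < s.re →
      DirichletBergman.IsPointEvaluation p α s δ ∧ ‖δ‖ ≤ c * (s.re / (2 * s.re - 1)) ^ β := by
    intro s
    by_cases hs : 1 / 2 < s.re
    · have h0 : 0 ≤ s.re / (2 * s.re - 1) := div_nonneg (by linarith) (by linarith)
      obtain ⟨δ, hδ⟩ := DirichletBergman.exists_isPointEvaluation p α (by positivity) (hev s hs)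
      exact ⟨δ, fun _ => hδ⟩
    -- Default value outside the half-plane, where nothing is claimed.
    · exact ⟨0, fun h => absurd h hs⟩
  choose δ hδ using hex
  refine ⟨δ, fun s hs => (hδ s hs).1, ⟨c, hc, fun s hs => (hδ s hs).2⟩,
    c * 4 ^ β + d * M, by positivity, fun s hs => ?_⟩
  have hx : 0 < 2 * s.re - 1 := by linarith
  rw [le_div_iff₀ (by positivity)]
  -- Below 4, multiplying (i) by (2 Re s - 1)^β leaves c (Re s)^β ≤ c 4^β; from 4 on, the decay
  -- 2^{-Re s} absorbs (2 Re s - 1)^β.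
  rcases lt_or_ge s.re 4 with h4 | h4
  · have h1 : ‖(δ s).comp (DirichletBergman.BergmanSpaceInfty p α).subtypeL‖
        ≤ c * (s.re / (2 * s.re - 1)) ^ β := by
      refine ((δ s).opNorm_comp_le _).trans (le_trans ?_ (hδ s hs).2)
      exact mul_le_of_le_one_right (norm_nonneg _) (Submodule.norm_subtypeL_le _)
    refine (mul_le_mul_of_nonneg_right h1 (by positivity)).trans ?_
    rw [mul_assoc, ← Real.mul_rpow (div_nonneg (by linarith) hx.le) hx.le,
      div_mul_cancel₀ _ hx.ne']
    have h2 : s.re ^ β ≤ 4 ^ β := Real.rpow_le_rpow (by linarith) h4.le hβ.le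
    have h3 := mul_le_mul_of_nonneg_left h2 hc.le
    have h4 : 0 < d * M := by positivity
    linarith
  · have h1 := (hδ s hs).1.norm_restrict_le p α (by positivity) (hsub s h4)
    have h2 : (2 * s.re - 1) ^ β ≤ M * 2 ^ s.re :=
      (Real.rpow_le_rpow hx.le (by linarith) hβ.le).trans (htwo s.re (by linarith))
    have h3 : 0 < c * 4 ^ β := by positivity
    calc ‖(δ s).comp (DirichletBergman.BergmanSpaceInfty p α).subtypeL‖ * (2 * s.re - 1) ^ β
        ≤ (d * 2 ^ (-s.re)) * (M * 2 ^ s.re) :=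
          mul_le_mul h1 h2 (by positivity) (by positivity)
      _ = d * M * (2 ^ (-s.re) * 2 ^ s.re) := by ring
      _ = d * M := by rw [← Real.rpow_add two_pos]; simp
      _ ≤ _ := by linarith
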